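/- Let $p=p_1\cdots p_N$ be a pattern, i.e. a finite word over a set of variables. A word $w$ over an alphabet encounters $p$ in the abelian sense if it contains a factor $u_1\cdots u_N$ with all $u_i$ nonempty and with $u_i$ a rearrangement of the letters of $u_j$ whenever $p_i=p_j$; otherwise $w$ avoids $p$ in the abelian sense. Suppose that $p$ uses $r$ distinct variables, the $j$-th one occurring $k_j\ge 1$ times, numbered so that $1=k_1=\cdots=k_s<k_{s+1}\le\cdots\le k_r$ (where $0\le s\le r$). For integers $m\ge 4$ and $k\ge 2$ the series $$S_{m,k}=\sum_{\ell=1}^{\infty}\frac{1}{m^{k\ell}}\sum_{i_1+\cdots+i_m=\ell}\binom{\ell}{i_1,\ldots,i_m}^{k}$$ (the inner sum being over nonnegative integers $i_1,\dots,i_m$) converges. Moreover, if $m\ge 4$ and $$n<(1+o(1))\left\{(s+1)!\prod_{j=s+1}^{r}S_{m,k_j}^{-1}\right\}^{\frac{1}{s+1}},$$ then there is a word of length $n$ over an alphabet of $m$ letters that avoids $p$ in the abelian sense. Here $o(1)$ stands for some real sequence $\varepsilon_n$ with $\varepsilon_n\to 0$ as $n\to\infty$, which depends neither on $m$ nor on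 $p$. -/

import Mathlib

open Filter Topology

/-- The word `w` encounters the pattern `p = p₁ ⋯ p_N` in the abelian sense: `w` has a factor
`u₁ ⋯ u_N` with all `uᵢ` nonempty and `uᵢ` a rearrangement of `uⱼ` whenever `pᵢ = pⱼ`. -/
def EncountersAbelian {V A : Type*} (p : List V) (w : List A) : Prop :=
  ∃ u : Fin p.length → List A,
    (∀ i, u i ≠ []) ∧
    (∀ i j, p.get i = p.get j → (u i).Perm (u j)) ∧
    (List.ofFn u).flatten <:+: w

/-- The word `w` avoids the pattern `p` in the abelian sense. -/
def AvoidsAbelian {V A : Type*} (p : List V) (w : List A) : Prop :=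
  ¬ EncountersAbelian p w

/-- `m^{-kℓ} ∑_{i₁ + ⋯ + i_m = ℓ} (ℓ choose i₁, …, i_m)^k`. -/
noncomputable def multinomialTerm (m k ℓ : ℕ) : ℝ :=
  1 / (m : ℝ) ^ (k * ℓ) *
    ∑ i ∈ Finset.piAntidiag (Finset.univ : Finset (Fin m)) ℓ,
      (Nat.multinomial Finset.univ i : ℝ) ^ k

/-- The sum of `multinomialTerm m k ℓ` over all `ℓ ≥ 1`. -/
noncomputable def multinomialSeries (m k : ℕ) : ℝ :=
  ∑' ℓ : ℕ, multinomialTerm m k (ℓ + 1)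

/-- The number `s` of variables that occur exactly once in the pattern `p`. -/
def numSingle {V : Type*} [DecidableEq V] (p : List V) : ℕ :=
  (p.toFinset.filter fun x => p.count x = 1).card

/-- `{(s+1)! ∏ (multinomialSeries m k_x)⁻¹}^{1/(s+1)}`, the product running over the variables `x`
that occur at least twice in `p`, where `k_x` is the number of occurrences of `x`. -/
noncomputable def abelianBound {V : Type*} [DecidableEq V] (m : ℕ) (p : List V) : ℝ :=
  (((numSingle p + 1).factorial : ℝ) *
    ∏ x ∈ p.toFinset.filter (fun x => 1 < p.count x), (multinomialSeries m (p.count x))⁻¹) ^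
      (1 / ((numSingle p : ℝ) + 1))

/-! A word that encounters `p` becomes, once a letter is put in front of it, a word that begins with
an instance of `z p`, where `z` is a variable that does not occur in `p`. It therefore suffices to
count the words of length `n + 1` that begin with an instance of `z p`. For prescribed lengths `ℓ x`
of the blocks, a random word over `m` letters does so with probability at most
`∏ x, multinomialTerm m (k x) (ℓ x)`. The factors with `k x = 1` are equal to `1`, so the sum over
the lengths of the `s + 1` single variables of `z p` is at most `(n + 1).choose (s + 1)`, and the
sum over the other lengths is at most `∏ multinomialSeries`. If all words of length `n` encounter
`p`, it follows that `1 ≤ (n + 1) ^ (s + 1) / (s + 1)! * ∏ multinomialSeries`, that is,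
`abelianBound m p ≤ n + 1`; the shift from `n` to `n + 1` is absorbed by `ε n = -1 / (n + 1)`.

For the convergence, Stirling's formula bounds the largest multinomial probability by a constant
times `ℓ ^ (-(m - 1) / 2)`. Since these probabilities add up to `1`, `multinomialTerm m k ℓ` is at
most a constant times `ℓ ^ (-(m - 1) * (k - 1) / 2)`. -/

section Words

variable {A : Type*}

open MvPolynomial in
theorem prod_map_X_eq_monomial [DecidableEq A] (w : List A) :
    (w.map (X : A → MvPolynomial A ℕ)).prod = monomial (Multiset.toFinsupp (w : Multiset A)) 1 := by
  induction w with
  | nil => simp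
  | cons a w ih =>
    rw [List.map_cons, List.prod_cons, ih, X, monomial_mul, one_mul, ← Multiset.cons_coe,
      ← Multiset.singleton_add, map_add, Multiset.toFinsupp_singleton]

/-- The words of length `n` over the alphabet `A`. -/
def wordsOfLength (A : Type*) [Fintype A] (n : ℕ) : Finset (List A) :=
  Finset.univ.map ⟨fun f : Fin n → A => List.ofFn f, List.ofFn_injective⟩

variable [Fintype A]

theorem mem_wordsOfLength {n : ℕ} {w : List A} : w ∈ wordsOfLength A n ↔ w.length = n := by
  simp only [wordsOfLength, Finset.mem_map, Finset.mem_univ, true_and, Function.Embedding.coeFn_mk]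
  constructor
  · rintro ⟨f, rfl⟩
    exact List.length_ofFn
  · rintro rfl
    exact ⟨w.get, List.ofFn_get w⟩

theorem card_wordsOfLength (n : ℕ) : (wordsOfLength A n).card = Fintype.card A ^ n := by
  simp [wordsOfLength]

theorem sum_wordsOfLength_prod_map {R : Type*} [CommSemiring R] (f : A → R) (n : ℕ) :
    ∑ w ∈ wordsOfLength A n, (w.map f).prod = (∑ a, f a) ^ n := by
  simp [wordsOfLength, Fintype.sum_pow, List.prod_ofFn]

variable [DecidableEq A]

theorem sum_count_eq_length (w : List A) : ∑ a, w.count a = w.length := by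
  simpa using Multiset.sum_count_eq_card (s := Finset.univ) (m := (w : Multiset A))
    (fun a _ => Finset.mem_univ a)

/-- The abelian equivalence class of the words in which each letter `a` occurs `v a` times. -/
def wordsOfCounts (v : A → ℕ) : Finset (List A) :=
  {w ∈ wordsOfLength A (∑ a, v a) | ∀ a, w.count a = v a}

theorem mem_wordsOfCounts {v : A → ℕ} {w : List A} :
    w ∈ wordsOfCounts v ↔ ∀ a, w.count a = v a := by
  simp only [wordsOfCounts, Finset.mem_filter, mem_wordsOfLength, and_iff_right_iff_imp]
  intro h
  simp only [← sum_count_eq_length, h]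

-- Compare the coefficients of `∏ a, X a ^ v a` in `∑ w, (w.map X).prod = (∑ a, X a) ^ n`.
theorem card_wordsOfCounts (v : A → ℕ) :
    (wordsOfCounts v).card = Nat.multinomial Finset.univ v := by
  let d : A →₀ ℕ := Finsupp.equivFunOnFinite.symm v
  have hd : d.sum (fun _ j => j) = ∑ a, v a := Finsupp.sum_fintype d _ fun _ => rfl
  have hcoeff := MvPolynomial.coeff_sum_X_pow_of_fintype (R := ℕ) d (∑ a, v a)
  rw [if_pos hd, ← sum_wordsOfLength_prod_map, MvPolynomial.coeff_sum,
    Finsupp.multinomial_eq_of_support_subset (Finset.subset_univ _)] at hcoeff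
  simp only [prod_map_X_eq_monomial, MvPolynomial.coeff_monomial, Finsupp.ext_iff,
    Multiset.toFinsupp_apply, Multiset.coe_count, Finset.sum_boole] at hcoeff
  exact hcoeff

end Words

section Instances

/-- A prefix of `w` is an instance `u₁ ⋯ u_N` of the pattern `p` in the abelian sense. -/
def BeginsWithAbelian {V A : Type*} (p : List V) (w : List A) : Prop :=
  ∃ u : Fin p.length → List A,
    (∀ i, u i ≠ []) ∧
    (∀ i j, p.get i = p.get j → (u i).Perm (u j)) ∧
    (List.ofFn u).flatten <+: w

-- The text before the factor, lengthened by `c` to make it nonempty, is the block of the new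
-- variable.
theorem EncountersAbelian.beginsWithAbelian_cons {V A : Type*} {p : List V} {w : List A}
    (h : EncountersAbelian p w) (c : A) :
    BeginsWithAbelian (none :: p.map some) (c :: w) := by
  obtain ⟨u, hne, hperm, s, t, rfl⟩ := h
  have hlen : (p.map some).length = p.length := List.length_map _
  refine ⟨Fin.cons (c :: s) fun i => u (i.cast hlen), ?_, ?_, t, ?_⟩
  · exact Fin.cases (List.cons_ne_nil c s) fun i => hne _
  · refine Fin.cases (Fin.cases (fun _ => .refl _) fun j hj => ?_) fun i =>
      Fin.cases (fun hi => ?_) fun j hij => ?_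
    · simp at hj
    · simp at hi
    · exact hperm _ _ (by simpa using hij)
  · simp

variable {V : Type*} [DecidableEq V]

/-- The variable at position `i` of `p`, as an element of the finite type of all its variables. -/
def variableAt (p : List V) (i : Fin p.length) : p.toFinset :=
  ⟨p.get i, List.mem_toFinset.2 (p.get_mem i)⟩

@[to_additive]
theorem prod_variableAt {M : Type*} [CommMonoid M] (p : List V) (f : p.toFinset → M) :
    ∏ i, f (variableAt p i) = ∏ x, f x ^ p.count x.1 := by
  rw [← Finset.prod_fiberwise' Finset.univ (variableAt p) f]
  refine Finset.prod_congr rfl fun x _ => ?_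
  have hcount : (Finset.univ.filter fun i => p.get i = x.1).card = p.count x.1 :=
    Fin.card_filter_univ_eq_vector_get_eq_count x.1 ⟨p, rfl⟩
  rw [Finset.prod_const, ← hcount]
  simp only [variableAt, Subtype.ext_iff]

variable {A : Type*} [Fintype A] [DecidableEq A]

/-- The words of length `n` that begin with an instance of `p` in which the blocks of each
variable `x` have the letter counts `v x`. -/
def wordsBeginningWith (p : List V) (n : ℕ) (v : p.toFinset → A → ℕ) : Finset (List A) :=
  ((Fintype.piFinset fun i => wordsOfCounts (v (variableAt p i))) ×ˢ
      wordsOfLength A (n - ∑ x : p.toFinset, p.count x.1 * ∑ a, v x a)).image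
    fun t => (List.ofFn t.1).flatten ++ t.2

theorem card_wordsBeginningWith_le (p : List V) (n : ℕ) (v : p.toFinset → A → ℕ) :
    (wordsBeginningWith p n v).card ≤
      (∏ x, Nat.multinomial Finset.univ (v x) ^ p.count x.1) *
        Fintype.card A ^ (n - ∑ x : p.toFinset, p.count x.1 * ∑ a, v x a) := by
  refine Finset.card_image_le.trans (le_of_eq ?_)
  simp only [Finset.card_product, Fintype.card_piFinset, card_wordsOfCounts, card_wordsOfLength]
  rw [prod_variableAt p fun x => Nat.multinomial Finset.univ (v x)]

/-- The possible lengths `ℓ x ≥ 1` of the blocks of the variables `x` in a word of length `n` that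
begins with an instance of a pattern in which `x` occurs `k x` times. -/
def blockLengths {X : Type*} [Fintype X] [DecidableEq X] (k : X → ℕ) (n : ℕ) : Finset (X → ℕ) :=
  {ℓ ∈ Fintype.piFinset fun _ => Finset.Icc 1 n | ∑ x, k x * ℓ x ≤ n}

theorem mem_blockLengths {X : Type*} [Fintype X] [DecidableEq X] {k : X → ℕ} (hk : ∀ x, 0 < k x)
    {n : ℕ} {ℓ : X → ℕ} :
    ℓ ∈ blockLengths k n ↔ (∀ x, 0 < ℓ x) ∧ ∑ x, k x * ℓ x ≤ n := by
  simp only [blockLengths, Finset.mem_filter, Fintype.mem_piFinset, Finset.mem_Icc]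
  refine ⟨fun h => ⟨fun x => (h.1 x).1, h.2⟩, fun h => ⟨fun x => ⟨h.1 x, ?_⟩, h.2⟩⟩
  calc ℓ x ≤ k x * ℓ x := Nat.le_mul_of_pos_left _ (hk x)
    _ ≤ ∑ x, k x * ℓ x :=
        Finset.single_le_sum (f := fun x => k x * ℓ x) (fun _ _ => Nat.zero_le _)
          (Finset.mem_univ x)
    _ ≤ n := h.2

theorem BeginsWithAbelian.exists_mem_wordsBeginningWith {p : List V} {w : List A}
    (h : BeginsWithAbelian p w) :
    ∃ ℓ ∈ blockLengths (fun x : p.toFinset => p.count x.1) w.length,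
      ∃ v ∈ Fintype.piFinset fun x => Finset.piAntidiag Finset.univ (ℓ x),
        w ∈ wordsBeginningWith p w.length v := by
  obtain ⟨u, hne, hperm, t, rfl⟩ := h
  have hsurj : Function.Surjective (variableAt p) := fun x => by
    obtain ⟨i, hi⟩ := List.get_of_mem (List.mem_toFinset.1 x.2)
    exact ⟨i, Subtype.ext hi⟩
  choose g hg using hsurj
  have hblock : ∀ i, (u i).Perm (u (g (variableAt p i))) := fun i =>
    hperm _ _ (congrArg Subtype.val (hg (variableAt p i))).symm
  let ℓ : p.toFinset → ℕ := fun x => (u (g x)).length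
  have hlen : ((List.ofFn u).flatten ++ t).length =
      ∑ x : p.toFinset, p.count x.1 * ℓ x + t.length := by
    have hsum := sum_variableAt p ℓ
    simp only [ℓ, ← (hblock _).length_eq, smul_eq_mul] at hsum
    simp only [List.length_append, List.length_flatten, List.map_ofFn, List.sum_ofFn,
      Function.comp_apply, hsum, ℓ]
  have hcount : ∀ x : p.toFinset, 0 < p.count x.1 := fun x =>
    List.count_pos_iff.2 (List.mem_toFinset.1 x.2)
  refine ⟨ℓ, (mem_blockLengths hcount).2 ⟨fun x => List.length_pos_of_ne_nil (hne _), ?_⟩,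
    fun x a => (u (g x)).count a, ?_, ?_⟩
  · exact hlen ▸ Nat.le_add_right _ _
  · simp [sum_count_eq_length, ℓ]
  · refine Finset.mem_image.2 ⟨(u, t), Finset.mem_product.2 ⟨?_, ?_⟩, rfl⟩
    · exact Fintype.mem_piFinset.2 fun i => mem_wordsOfCounts.2 (hblock i).count_eq
    · simp only [mem_wordsOfLength, sum_count_eq_length, hlen]
      exact (Nat.add_sub_cancel_left _ _).symm

theorem sum_card_wordsBeginningWith_le {m n : ℕ} (hm : 0 < m) (p : List V) {ℓ : p.toFinset → ℕ}
    (hℓ : ∑ x : p.toFinset, p.count x.1 * ℓ x ≤ n) :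
    ∑ v ∈ Fintype.piFinset fun x => Finset.piAntidiag (Finset.univ : Finset (Fin m)) (ℓ x),
        ((wordsBeginningWith p n v).card : ℝ) ≤
      m ^ n * ∏ x : p.toFinset, multinomialTerm m (p.count x.1) (ℓ x) := by
  set L := ∑ x : p.toFinset, p.count x.1 * ℓ x
  calc ∑ v ∈ Fintype.piFinset fun x => Finset.piAntidiag (Finset.univ : Finset (Fin m)) (ℓ x),
        ((wordsBeginningWith p n v).card : ℝ)
      ≤ ∑ v ∈ Fintype.piFinset fun x => Finset.piAntidiag (Finset.univ : Finset (Fin m)) (ℓ x),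
          (∏ x, (Nat.multinomial Finset.univ (v x) : ℝ) ^ p.count x.1) * m ^ (n - L) := by
        refine Finset.sum_le_sum fun v hv => ?_
        have hsum : ∀ x, ∑ a, v x a = ℓ x := fun x =>
          (Finset.mem_piAntidiag.1 (Fintype.mem_piFinset.1 hv x)).1
        have hcard := card_wordsBeginningWith_le p n v
        simp only [hsum, Fintype.card_fin] at hcard
        exact_mod_cast hcard
    _ = (∏ x, ∑ v ∈ Finset.piAntidiag (Finset.univ : Finset (Fin m)) (ℓ x),
          (Nat.multinomial Finset.univ v : ℝ) ^ p.count x.1) * m ^ (n - L) := by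
        rw [Finset.prod_univ_sum, Finset.sum_mul]
    _ = m ^ n * ∏ x : p.toFinset, multinomialTerm m (p.count x.1) (ℓ x) := by
        have hpow : (m : ℝ) ^ n = m ^ (n - L) * m ^ L := by rw [← pow_add, Nat.sub_add_cancel hℓ]
        have : (m : ℝ) ≠ 0 := by positivity
        simp only [multinomialTerm, Finset.prod_mul_distrib, Finset.prod_div_distrib,
          Finset.prod_const_one, Finset.prod_pow_eq_pow_sum, hpow, L]
        field_simp

theorem one_le_sum_of_forall_beginsWithAbelian {m n : ℕ} (hm : 0 < m) (p : List V)
    (h : ∀ w : List (Fin m), w.length = n → BeginsWithAbelian p w) :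
    1 ≤ ∑ ℓ ∈ blockLengths (fun x : p.toFinset => p.count x.1) n,
      ∏ x : p.toFinset, multinomialTerm m (p.count x.1) (ℓ x) := by
  have hcover : wordsOfLength (Fin m) n ⊆
      (blockLengths (fun x : p.toFinset => p.count x.1) n).biUnion fun ℓ =>
        (Fintype.piFinset fun x => Finset.piAntidiag Finset.univ (ℓ x)).biUnion
          (wordsBeginningWith p n) := fun w hw => by
    obtain rfl := mem_wordsOfLength.1 hw
    simpa only [Finset.mem_biUnion] using (h w rfl).exists_mem_wordsBeginningWith
  have hcard : (m : ℝ) ^ n ≤ ∑ ℓ ∈ blockLengths (fun x : p.toFinset => p.count x.1) n,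
      ∑ v ∈ Fintype.piFinset fun x => Finset.piAntidiag (Finset.univ : Finset (Fin m)) (ℓ x),
        ((wordsBeginningWith p n v).card : ℝ) := by
    have := (Finset.card_le_card hcover).trans (Finset.card_biUnion_le.trans
      (Finset.sum_le_sum fun ℓ _ => Finset.card_biUnion_le))
    rw [card_wordsOfLength, Fintype.card_fin] at this
    exact_mod_cast this
  refine le_of_mul_le_mul_left (a := (m : ℝ) ^ n) ?_ (by positivity)
  rw [mul_one, Finset.mul_sum]
  exact hcard.trans (Finset.sum_le_sum fun ℓ hℓ =>
    sum_card_wordsBeginningWith_le hm p (Finset.mem_filter.1 hℓ).2)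

end Instances

section MultinomialTerm

theorem multinomialTerm_eq_sum (m k ℓ : ℕ) :
    multinomialTerm m k ℓ = ∑ v ∈ Finset.piAntidiag (Finset.univ : Finset (Fin m)) ℓ,
      ((Nat.multinomial Finset.univ v : ℝ) / (m : ℝ) ^ ℓ) ^ k := by
  rw [multinomialTerm, Finset.mul_sum]
  refine Finset.sum_congr rfl fun v _ => ?_
  rw [div_pow, ← pow_mul, mul_comm k ℓ, one_div_mul_eq_div]

theorem multinomialTerm_nonneg (m k ℓ : ℕ) : 0 ≤ multinomialTerm m k ℓ := by
  rw [multinomialTerm_eq_sum]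
  positivity

theorem multinomialSeries_nonneg (m k : ℕ) : 0 ≤ multinomialSeries m k :=
  tsum_nonneg fun _ => multinomialTerm_nonneg _ _ _

theorem multinomialTerm_one {m : ℕ} (hm : 0 < m) (ℓ : ℕ) : multinomialTerm m 1 ℓ = 1 := by
  have h := Finset.sum_pow_eq_sum_piAntidiag (Finset.univ : Finset (Fin m)) (fun _ => (1 : ℝ)) ℓ
  simp only [Finset.sum_const, Finset.card_univ, Fintype.card_fin, nsmul_eq_mul, mul_one, one_pow,
    Finset.prod_const_one] at h
  simp only [multinomialTerm, one_mul, pow_one, ← h]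
  exact one_div_mul_cancel (by positivity)

theorem sum_Icc_multinomialTerm_le {m k : ℕ}
    (hS : Summable fun ℓ : ℕ => multinomialTerm m k (ℓ + 1)) (n : ℕ) :
    ∑ j ∈ Finset.Icc 1 n, multinomialTerm m k j ≤ multinomialSeries m k := by
  calc ∑ j ∈ Finset.Icc 1 n, multinomialTerm m k j
      = ∑ j ∈ Finset.range n, multinomialTerm m k (j + 1) := by
        rw [Finset.range_eq_Ico, Finset.sum_Ico_add' _ 0 n 1]
        rfl
    _ ≤ multinomialSeries m k := hS.sum_le_tsum _ fun _ _ => multinomialTerm_nonneg _ _ _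

end MultinomialTerm

section UnionBound

variable {X : Type*} [Fintype X] [DecidableEq X]

-- Lowering each `ℓ x` by `1` and recording `n - ∑ x, ℓ x` as a further coordinate gives a weak
-- composition of `n - card X` into `card X + 1` parts.
theorem card_blockLengths_one_le (n : ℕ) :
    (blockLengths (1 : X → ℕ) n).card ≤ n.choose (Fintype.card X) := by
  have hmem : ∀ ℓ ∈ blockLengths (1 : X → ℕ) n, (∀ x, 0 < ℓ x) ∧
      ∑ x, (ℓ x - 1) + Fintype.card X ≤ n := fun ℓ hℓ => by
    obtain ⟨hpos, hsum⟩ := (mem_blockLengths fun _ => one_pos).1 hℓ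
    refine ⟨hpos, le_of_eq_of_le ?_ hsum⟩
    have hsub : ∀ x, ℓ x - 1 + 1 = ℓ x := fun x => Nat.sub_add_cancel (hpos x)
    simp only [Fintype.card_eq_sum_ones, ← Finset.sum_add_distrib, hsub, one_mul]
  rcases lt_or_ge n (Fintype.card X) with hn | hn
  · have hempty : blockLengths (1 : X → ℕ) n = ∅ :=
      Finset.eq_empty_of_forall_notMem fun ℓ hℓ => by have := (hmem ℓ hℓ).2; omega
    simp [hempty]
  have hcard : (Finset.piAntidiag (Finset.univ : Finset (Option X)) (n - Fintype.card X)).card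
      = n.choose (Fintype.card X) := by
    rw [← Finset.map_sym_eq_piAntidiag, Finset.card_map, Finset.sym_univ, Finset.card_univ,
      Sym.card_sym_eq_choose, Fintype.card_option, ← Nat.choose_symm hn]
    congr 1
    omega
  rw [← hcard]
  refine Finset.card_le_card_of_injOn (fun ℓ o => o.elim
    (n - Fintype.card X - ∑ x, (ℓ x - 1)) fun x => ℓ x - 1) (fun ℓ hℓ => ?_) fun ℓ hℓ ℓ' hℓ' h => ?_
  · have := (hmem ℓ hℓ).2
    simp only [Finset.mem_coe, Finset.mem_piAntidiag, Finset.mem_univ, implies_true, and_true,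
      Fintype.sum_option, Option.elim]
    omega
  · funext x
    have hx : ℓ x - 1 = ℓ' x - 1 := congrFun h (some x)
    have := (hmem ℓ hℓ).1 x
    have := (hmem ℓ' hℓ').1 x
    omega

theorem map_blockLengths_subset (k : X → ℕ) (n : ℕ) :
    (blockLengths k n).map
        (Equiv.piEquivPiSubtypeProd (fun x => k x = 1) fun _ => ℕ).toEmbedding ⊆
      blockLengths 1 n ×ˢ Fintype.piFinset fun _ => Finset.Icc 1 n := by
  intro gh hgh
  obtain ⟨ℓ, hℓ, rfl⟩ := Finset.mem_map.1 hgh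
  obtain ⟨hIcc, hsum⟩ := Finset.mem_filter.1 hℓ
  rw [Fintype.mem_piFinset] at hIcc
  refine Finset.mem_product.2 ⟨Finset.mem_filter.2 ⟨?_, ?_⟩, ?_⟩
  · exact Fintype.mem_piFinset.2 fun x => hIcc x
  · calc ∑ x : {x // k x = 1}, 1 * ℓ x
        = ∑ x : {x // k x = 1}, k x * ℓ x := Finset.sum_congr rfl fun x _ => by rw [x.2]
      _ ≤ ∑ x, k x * ℓ x := by
        rw [← Fintype.sum_subtype_add_sum_subtype (fun x => k x = 1) fun x => k x * ℓ x]
        exact Nat.le_add_right _ _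
      _ ≤ n := hsum
  · exact Fintype.mem_piFinset.2 fun x => hIcc x

theorem sum_prod_multinomialTerm_le {m : ℕ} (hm : 0 < m) (k : X → ℕ)
    (hS : ∀ x, k x ≠ 1 → Summable fun ℓ : ℕ => multinomialTerm m (k x) (ℓ + 1)) (n : ℕ) :
    ∑ ℓ ∈ blockLengths k n, ∏ x, multinomialTerm m (k x) (ℓ x) ≤
      n.choose (Fintype.card {x // k x = 1}) *
        ∏ x : {x // ¬ k x = 1}, multinomialSeries m (k x) := by
  have hterm : ∀ ℓ : X → ℕ, ∏ x, multinomialTerm m (k x) (ℓ x) =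
      ∏ x : {x // ¬ k x = 1}, multinomialTerm m (k x) (ℓ x) := fun ℓ => by
    rw [← Fintype.prod_subtype_mul_prod_subtype (fun x => k x = 1),
      Finset.prod_eq_one fun x _ => by rw [x.2, multinomialTerm_one hm], one_mul]
  calc ∑ ℓ ∈ blockLengths k n, ∏ x, multinomialTerm m (k x) (ℓ x)
      = ∑ gh ∈ (blockLengths k n).map
            (Equiv.piEquivPiSubtypeProd (fun x => k x = 1) fun _ => ℕ).toEmbedding,
          ∏ x : {x // ¬ k x = 1}, multinomialTerm m (k x) (gh.2 x) := by
        rw [Finset.sum_map]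
        exact Finset.sum_congr rfl fun ℓ _ => hterm ℓ
    _ ≤ ∑ gh ∈ blockLengths (1 : {x // k x = 1} → ℕ) n ×ˢ
            Fintype.piFinset fun _ => Finset.Icc 1 n,
          ∏ x : {x // ¬ k x = 1}, multinomialTerm m (k x) (gh.2 x) :=
        Finset.sum_le_sum_of_subset_of_nonneg (map_blockLengths_subset k n) fun _ _ _ =>
          Finset.prod_nonneg fun _ _ => multinomialTerm_nonneg _ _ _
    _ = (blockLengths (1 : {x // k x = 1} → ℕ) n).card *
          ∏ x : {x // ¬ k x = 1}, ∑ j ∈ Finset.Icc 1 n, multinomialTerm m (k x) j := by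
        simp only [Finset.sum_product, Finset.sum_const, nsmul_eq_mul, Finset.prod_univ_sum]
    _ ≤ n.choose (Fintype.card {x // k x = 1}) *
          ∏ x : {x // ¬ k x = 1}, multinomialSeries m (k x) := by
        refine mul_le_mul (mod_cast card_blockLengths_one_le n)
          (Finset.prod_le_prod (fun x _ => ?_) fun x _ => sum_Icc_multinomialTerm_le (hS x x.2) n)
          (Finset.prod_nonneg fun x _ => ?_) (Nat.cast_nonneg _) <;>
        exact Finset.sum_nonneg fun _ _ => multinomialTerm_nonneg _ _ _

variable {V : Type*} [DecidableEq V]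

theorem one_le_choose_mul_prod_of_forall_beginsWithAbelian {m n : ℕ} (hm : 0 < m) {p : List V}
    (hS : ∀ x ∈ p, 1 < p.count x →
      Summable fun ℓ : ℕ => multinomialTerm m (p.count x) (ℓ + 1))
    (h : ∀ w : List (Fin m), w.length = n → BeginsWithAbelian p w) :
    1 ≤ (n.choose (numSingle p) : ℝ) *
      ∏ x ∈ p.toFinset with 1 < p.count x, multinomialSeries m (p.count x) := by
  have hpos : ∀ x : p.toFinset, 0 < p.count x.1 := fun x =>
    List.count_pos_iff.2 (List.mem_toFinset.1 x.2)
  have hle := (one_le_sum_of_forall_beginsWithAbelian hm p h).trans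
    (sum_prod_multinomialTerm_le hm (fun x : p.toFinset => p.count x.1)
      (fun x hx => hS x.1 (List.mem_toFinset.1 x.2) (by have := hpos x; omega)) n)
  have hsingle : Fintype.card {x : p.toFinset // p.count x.1 = 1} = numSingle p := by
    rw [numSingle, Fintype.card_subtype, Finset.card_filter, Finset.card_filter,
      ← Finset.sum_coe_sort p.toFinset]
  have hprod : ∏ x : {x : p.toFinset // ¬ p.count x.1 = 1}, multinomialSeries m (p.count x.1.1)
      = ∏ x ∈ p.toFinset with 1 < p.count x, multinomialSeries m (p.count x) := by
    rw [← Finset.prod_subtype (Finset.univ.filter fun x : p.toFinset => ¬ p.count x.1 = 1)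
        (by simp) fun x : p.toFinset => multinomialSeries m (p.count x.1),
      Finset.prod_filter, Finset.prod_filter, ← Finset.prod_coe_sort p.toFinset]
    exact Finset.prod_congr rfl fun x _ => if_congr (by have := hpos x; omega) rfl rfl
  rwa [hsingle, hprod] at hle

section FreshVariable

variable {W : Type*} [DecidableEq W] {f : V → W} {z : W}

theorem count_cons_map (hf : f.Injective) (hz : ∀ x, f x ≠ z) (p : List V) (x : V) :
    (z :: p.map f).count (f x) = p.count x := by
  rw [List.count_cons_of_ne (hz x).symm, List.count_map_of_injective _ _ hf]

@[to_additive]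
theorem prod_count_cons_map {M : Type*} [CommMonoid M] (hf : f.Injective) (hz : ∀ x, f x ≠ z)
    (p : List V) (F : ℕ → M) :
    ∏ y ∈ (z :: p.map f).toFinset, F ((z :: p.map f).count y) =
      F 1 * ∏ x ∈ p.toFinset, F (p.count x) := by
  have hmem : z ∉ p.map f := fun h => by
    obtain ⟨x, -, hx⟩ := List.mem_map.1 h
    exact hz x hx
  have himage : (p.map f).toFinset = p.toFinset.image f := by
    ext y
    simp
  rw [List.toFinset_cons, Finset.prod_insert (mt List.mem_toFinset.1 hmem), List.count_cons_self,
    List.count_eq_zero.2 hmem, himage, Finset.prod_image hf.injOn]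
  simp only [count_cons_map hf hz]

theorem numSingle_cons_map (hf : f.Injective) (hz : ∀ x, f x ≠ z) (p : List V) :
    numSingle (z :: p.map f) = numSingle p + 1 := by
  simp only [numSingle, Finset.card_filter]
  rw [sum_count_cons_map hf hz p fun k => if k = 1 then 1 else 0, if_pos rfl, add_comm]

theorem prod_count_gt_one_cons_map {M : Type*} [CommMonoid M] (hf : f.Injective)
    (hz : ∀ x, f x ≠ z) (p : List V) (F : ℕ → M) :
    ∏ y ∈ (z :: p.map f).toFinset with 1 < (z :: p.map f).count y, F ((z :: p.map f).count y) =
      ∏ x ∈ p.toFinset with 1 < p.count x, F (p.count x) := by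
  simp only [Finset.prod_filter]
  rw [prod_count_cons_map hf hz p fun k => if 1 < k then F k else 1, if_neg (lt_irrefl 1), one_mul]

end FreshVariable

theorem one_le_choose_mul_prod_of_forall_encountersAbelian {m n : ℕ} (hm : 0 < m) {p : List V}
    (hS : ∀ x ∈ p, 1 < p.count x →
      Summable fun ℓ : ℕ => multinomialTerm m (p.count x) (ℓ + 1))
    (h : ∀ w : List (Fin m), w.length = n → EncountersAbelian p w) :
    1 ≤ ((n + 1).choose (numSingle p + 1) : ℝ) *
      ∏ x ∈ p.toFinset with 1 < p.count x, multinomialSeries m (p.count x) := by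
  have hf := Option.some_injective V
  have hz : ∀ x : V, some x ≠ none := Option.some_ne_none
  rw [← numSingle_cons_map hf hz, ← prod_count_gt_one_cons_map hf hz]
  refine one_le_choose_mul_prod_of_forall_beginsWithAbelian hm ?_ fun w hw => ?_
  · rintro (_ | x) hx hcount
    · simp at hcount
    · rw [count_cons_map hf hz] at hcount ⊢
      exact hS x (by simpa using hx) hcount
  · obtain ⟨c, w, rfl⟩ := List.exists_cons_of_length_eq_add_one hw
    exact (h w (by simpa using hw)).beginsWithAbelian_cons c

end UnionBound

section Summability

theorem pow_mul_exp_neg_le {x : ℝ} (hx : 0 ≤ x) (n : ℕ) :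
    x ^ n * Real.exp (-x) ≤ (n / Real.exp 1) ^ n := by
  rcases n.eq_zero_or_pos with rfl | hn
  · simpa using hx
  have hle : x / n ≤ Real.exp (x / n - 1) := by linarith [Real.add_one_le_exp (x / n - 1)]
  calc x ^ n * Real.exp (-x) = n ^ n * (x / n) ^ n * Real.exp (-x) := by
        rw [← mul_pow, mul_div_cancel₀ _ (by positivity)]
    _ ≤ n ^ n * Real.exp (x / n - 1) ^ n * Real.exp (-x) := by gcongr
    _ = (n / Real.exp 1) ^ n := by
        rw [← mul_pow, Real.exp_sub, mul_div_assoc', mul_div_right_comm, mul_pow,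
          ← Real.exp_nat_mul (x / n), mul_div_cancel₀ _ (by positivity), mul_assoc, ← Real.exp_add,
          add_neg_cancel, Real.exp_zero, mul_one]

-- The left-hand side is the maximum of `(√t * exp (-t) * t ^ i) ^ 2` over `t ≥ 0`.
theorem add_half_div_exp_pow_le_factorial_sq (i : ℕ) :
    ((i + 1 / 2) / Real.exp 1) ^ (2 * i + 1) ≤ (i.factorial : ℝ) ^ 2 := by
  rcases i.eq_zero_or_pos with rfl | hi
  · have : 1 / 2 / Real.exp 1 ≤ 1 :=
      (div_le_one (Real.exp_pos 1)).2 (by linarith [Real.add_one_le_exp 1])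
    simpa using this
  have hi1 : (1 : ℝ) ≤ i := by exact_mod_cast hi
  have hratio : (1 + 1 / (2 * i) : ℝ) ^ (2 * i + 1) ≤ Real.exp 2 := by
    calc (1 + 1 / (2 * i) : ℝ) ^ (2 * i + 1) ≤ Real.exp (1 / (2 * i)) ^ (2 * i + 1) := by
          gcongr
          rw [add_comm]
          exact Real.add_one_le_exp _
      _ ≤ Real.exp 2 := by
          rw [← Real.exp_nat_mul, Real.exp_le_exp]
          push_cast
          field_simp
          linarith
  calc ((i + 1 / 2) / Real.exp 1) ^ (2 * i + 1)
      = (1 + 1 / (2 * i) : ℝ) ^ (2 * i + 1) * (i / Real.exp 1) ^ (2 * i + 1) := by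
        rw [← mul_pow]
        congr 1
        field_simp
    _ ≤ Real.exp 2 * (i / Real.exp 1) ^ (2 * i + 1) := by gcongr
    _ = Real.exp 1 * i * ((i / Real.exp 1) ^ i) ^ 2 := by
        rw [show Real.exp 2 = Real.exp 1 * Real.exp 1 by rw [← Real.exp_add]; norm_num,
          pow_succ, mul_comm 2 i, pow_mul]
        field_simp
    _ ≤ 2 * Real.pi * i * ((i / Real.exp 1) ^ i) ^ 2 := by
        gcongr
        linarith [Real.exp_one_lt_three, Real.pi_gt_three]
    _ = (√(2 * Real.pi * i) * (i / Real.exp 1) ^ i) ^ 2 := by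
        rw [mul_pow, Real.sq_sqrt (by positivity)]
    _ ≤ (i.factorial : ℝ) ^ 2 := by
        gcongr
        exact Stirling.le_factorial_stirling i

theorem sqrt_mul_exp_neg_mul_pow_le_factorial {t : ℝ} (ht : 0 ≤ t) (i : ℕ) :
    √t * Real.exp (-t) * t ^ i ≤ i.factorial := by
  refine le_of_sq_le_sq ?_ (Nat.cast_nonneg _)
  calc (√t * Real.exp (-t) * t ^ i) ^ 2
      = (2 * t) ^ (2 * i + 1) * Real.exp (-(2 * t)) / 2 ^ (2 * i + 1) := by
        rw [mul_pow, mul_pow, Real.sq_sqrt ht, ← Real.exp_nat_mul]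
        field_simp
        ring_nf
    _ ≤ ((2 * i + 1 : ℕ) / Real.exp 1) ^ (2 * i + 1) / 2 ^ (2 * i + 1) := by
        gcongr
        exact pow_mul_exp_neg_le (by positivity) _
    _ = ((i + 1 / 2) / Real.exp 1) ^ (2 * i + 1) := by
        rw [← div_pow]
        congr 1
        push_cast
        field_simp
    _ ≤ (i.factorial : ℝ) ^ 2 := add_half_div_exp_pow_le_factorial_sq i

theorem factorial_le_stirling {n : ℕ} (hn : 0 < n) :
    (n.factorial : ℝ) ≤ Real.exp 1 * √n * (n / Real.exp 1) ^ n := by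
  obtain ⟨k, rfl⟩ := Nat.exists_eq_succ_of_ne_zero hn.ne'
  have h : Stirling.stirlingSeq (k + 1) ≤ Stirling.stirlingSeq 1 :=
    Stirling.stirlingSeq'_antitone (Nat.zero_le k)
  rw [Stirling.stirlingSeq_one, Stirling.stirlingSeq, div_le_iff₀ (by positivity)] at h
  refine h.trans (le_of_eq ?_)
  rw [Real.sqrt_mul (by norm_num)]
  field_simp

section Multinomial

variable {A : Type*} [Fintype A]

theorem pow_mul_pow_sum_le_prod_factorial {t : ℝ} (ht : 0 ≤ t) (v : A → ℕ) :
    (√t * Real.exp (-t)) ^ Fintype.card A * t ^ (∑ a, v a) ≤ ∏ a, ((v a).factorial : ℝ) := by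
  calc (√t * Real.exp (-t)) ^ Fintype.card A * t ^ (∑ a, v a)
      = ∏ a, (√t * Real.exp (-t) * t ^ v a) := by
        rw [Finset.prod_mul_distrib, Finset.prod_pow_eq_pow_sum, Finset.prod_const,
          Finset.card_univ]
    _ ≤ ∏ a, ((v a).factorial : ℝ) := Finset.prod_le_prod (fun _ _ => by positivity)
        fun a _ => sqrt_mul_exp_neg_mul_pow_le_factorial ht (v a)

theorem multinomial_div_card_pow_le {v : A → ℕ} (hv : 0 < ∑ a, v a) :
    (Nat.multinomial Finset.univ v : ℝ) / (Fintype.card A : ℝ) ^ (∑ a, v a) ≤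
      Real.exp 1 * √(Fintype.card A) ^ Fintype.card A /
        √(∑ a, v a : ℕ) ^ (Fintype.card A - 1) := by
  have hA : 0 < Fintype.card A := Fintype.card_pos_iff.2 <| by
    obtain ⟨a, -, -⟩ := Finset.exists_ne_zero_of_sum_ne_zero hv.ne'
    exact ⟨a⟩
  have hspec : (∏ a, ((v a).factorial : ℝ)) * Nat.multinomial Finset.univ v =
      (∑ a, v a).factorial := by exact_mod_cast Nat.multinomial_spec Finset.univ v
  have hprod := pow_mul_pow_sum_le_prod_factorial
    (by positivity : (0 : ℝ) ≤ (∑ a, v a : ℕ) / Fintype.card A) v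
  set m := Fintype.card A
  set ℓ := ∑ a, v a
  set r : ℝ := √ℓ * (ℓ / Real.exp 1) ^ ℓ with hr
  have hlhs : (√(ℓ / m) * Real.exp (-(ℓ / m))) ^ m * (ℓ / m : ℝ) ^ ℓ =
      √ℓ ^ (m - 1) / (√m ^ m * m ^ ℓ) * r := by
    rw [mul_pow, ← Real.exp_nat_mul, mul_neg, mul_div_cancel₀ _ (by positivity),
      Real.sqrt_div (Nat.cast_nonneg ℓ), div_pow, div_pow, hr, div_pow, ← Real.exp_nat_mul,
      mul_one, Real.exp_neg, ← Nat.sub_add_cancel hA, pow_succ √(ℓ : ℝ)]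
    field_simp
    simp only [Nat.add_sub_cancel]
  have hmain : √ℓ ^ (m - 1) / (√m ^ m * m ^ ℓ) * Nat.multinomial Finset.univ v ≤ Real.exp 1 := by
    refine le_of_mul_le_mul_right ?_ (by positivity : 0 < r)
    calc √ℓ ^ (m - 1) / (√m ^ m * m ^ ℓ) * Nat.multinomial Finset.univ v * r
        = √ℓ ^ (m - 1) / (√m ^ m * m ^ ℓ) * r * Nat.multinomial Finset.univ v := by ring
      _ ≤ (∏ a, ((v a).factorial : ℝ)) * Nat.multinomial Finset.univ v := by
          rw [← hlhs]
          gcongr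
      _ = ℓ.factorial := hspec
      _ ≤ Real.exp 1 * r := by
          rw [hr, ← mul_assoc]
          exact factorial_le_stirling hv
  rw [div_mul_eq_mul_div, div_le_iff₀ (by positivity)] at hmain
  rw [div_le_div_iff₀ (by positivity) (by positivity)]
  linarith

end Multinomial

theorem multinomialTerm_succ_le {m ℓ : ℕ} (hm : 0 < m) {B : ℝ}
    (hB : ∀ v : Fin m → ℕ, ∑ j, v j = ℓ →
      (Nat.multinomial Finset.univ v : ℝ) / (m : ℝ) ^ ℓ ≤ B) (k : ℕ) :
    multinomialTerm m (k + 1) ℓ ≤ B ^ k := by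
  have hone := multinomialTerm_one hm ℓ
  rw [multinomialTerm_eq_sum] at hone ⊢
  simp only [pow_one] at hone
  calc ∑ v ∈ Finset.piAntidiag (Finset.univ : Finset (Fin m)) ℓ,
        ((Nat.multinomial Finset.univ v : ℝ) / (m : ℝ) ^ ℓ) ^ (k + 1)
      ≤ ∑ v ∈ Finset.piAntidiag (Finset.univ : Finset (Fin m)) ℓ,
          B ^ k * ((Nat.multinomial Finset.univ v : ℝ) / (m : ℝ) ^ ℓ) := by
        refine Finset.sum_le_sum fun v hv => ?_
        rw [pow_succ]
        gcongr
        exact hB v (Finset.mem_piAntidiag.1 hv).1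
    _ = B ^ k := by rw [← Finset.mul_sum, hone, mul_one]

theorem summable_inv_sqrt_pow {d : ℕ} (hd : 3 ≤ d) : Summable fun n : ℕ => (√(n : ℝ) ^ d)⁻¹ := by
  have hd' : (1 : ℝ) < 1 / 2 * d := by
    have : (3 : ℝ) ≤ d := by exact_mod_cast hd
    linarith
  refine (Real.summable_nat_rpow_inv.2 hd').congr fun n => ?_
  rw [Real.rpow_mul_natCast n.cast_nonneg, Real.sqrt_eq_rpow]

theorem summable_multinomialTerm {m k : ℕ} (h : 3 ≤ (m - 1) * (k - 1)) :
    Summable fun ℓ : ℕ => multinomialTerm m k (ℓ + 1) := by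
  rcases k with _ | k
  · simp at h
  have hm : 0 < m := Nat.pos_of_ne_zero fun hm => by simp [hm] at h
  refine Summable.of_nonneg_of_le (fun ℓ => multinomialTerm_nonneg _ _ _) (fun ℓ => ?_)
    (((summable_nat_add_iff 1).2 (summable_inv_sqrt_pow h)).mul_left
      ((Real.exp 1 * √m ^ m) ^ k))
  refine (multinomialTerm_succ_le hm (fun v hv => ?_) k).trans_eq
    (b := (Real.exp 1 * √m ^ m / √(ℓ + 1 : ℕ) ^ (m - 1)) ^ k) ?_
  · have := multinomial_div_card_pow_le (v := v) (by omega)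
    rwa [hv, Fintype.card_fin] at this
  · rw [div_pow, ← pow_mul, div_eq_mul_inv, Nat.add_sub_cancel]

end Summability

section Avoidance

variable {V : Type*} [DecidableEq V]

theorem exists_avoidsAbelian_of_succ_lt_abelianBound {p : List V} {m n : ℕ} (hm : 0 < m)
    (hS : ∀ x ∈ p, 1 < p.count x →
      Summable fun ℓ : ℕ => multinomialTerm m (p.count x) (ℓ + 1))
    (hn : (n + 1 : ℝ) < abelianBound m p) :
    ∃ w : List (Fin m), w.length = n ∧ AvoidsAbelian p w := by
  by_contra! hcon
  have hone := one_le_choose_mul_prod_of_forall_encountersAbelian hm hS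
    fun w hw => not_not.1 (hcon w hw)
  rw [abelianBound, Finset.prod_inv_distrib] at hn
  set S := ∏ x ∈ p.toFinset with 1 < p.count x, multinomialSeries m (p.count x)
  have hS0 : 0 ≤ S := Finset.prod_nonneg fun _ _ => multinomialSeries_nonneg _ _
  rw [one_div, Real.lt_rpow_inv_iff_of_pos (by positivity) (by positivity) (by positivity)] at hn
  have hlt : (n + 1 : ℝ) ^ (numSingle p + 1) / (numSingle p + 1).factorial < S⁻¹ := by
    rw [div_lt_iff₀' (by positivity)]
    exact_mod_cast hn
  have hchoose : ((n + 1).choose (numSingle p + 1) : ℝ) < S⁻¹ := by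
    refine lt_of_le_of_lt ?_ hlt
    exact_mod_cast Nat.choose_le_pow_div (α := ℝ) (numSingle p + 1) (n + 1)
  have hpos : 0 < S := inv_pos.1 ((Nat.cast_nonneg _).trans_lt hchoose)
  rw [← one_div, lt_div_iff₀ hpos] at hchoose
  exact hchoose.not_ge hone

end Avoidance

theorem mainTheorem5_general :
    (∀ m k : ℕ, 3 ≤ (m - 1) * (k - 1) → Summable fun ℓ : ℕ => multinomialTerm m k (ℓ + 1)) ∧
    ∃ ε : ℕ → ℝ, Tendsto ε atTop (𝓝 0) ∧
      ∀ (V : Type*) [DecidableEq V] (p : List V) (m n : ℕ), 0 < m →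
        (∀ x ∈ p, 1 < p.count x → 3 ≤ (m - 1) * (p.count x - 1)) →
          (n : ℝ) < (1 + ε n) * abelianBound m p →
            ∃ w : List (Fin m), w.length = n ∧ AvoidsAbelian p w := by
  refine ⟨fun m k => summable_multinomialTerm, fun n => -(1 / ((n : ℝ) + 1)), ?_, ?_⟩
  · simpa using tendsto_one_div_add_atTop_nhds_zero_nat (𝕜 := ℝ).neg
  · intro V _ p m n hm hk h
    refine exists_avoidsAbelian_of_succ_lt_abelianBound hm
      (fun x hx hcount => summable_multinomialTerm (hk x hx hcount)) ?_
    have hε : 1 + -(1 / ((n : ℝ) + 1)) = n / (n + 1) := by field_simp; ring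
    rw [hε, div_mul_eq_mul_div, lt_div_iff₀ (by positivity)] at h
    exact lt_of_mul_lt_mul_left h n.cast_nonneg

theorem mainTheorem5 :
    (∀ m k : ℕ, 4 ≤ m → 2 ≤ k → Summable fun ℓ : ℕ => multinomialTerm m k (ℓ + 1)) ∧
    ∃ ε : ℕ → ℝ, Tendsto ε atTop (𝓝 0) ∧
      ∀ (V : Type*) [DecidableEq V] (p : List V) (m n : ℕ), 4 ≤ m →
        (n : ℝ) < (1 + ε n) * abelianBound m p →
          ∃ w : List (Fin m), w.length = n ∧ AvoidsAbelian p w := by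
  have hmk : ∀ m k : ℕ, 4 ≤ m → 2 ≤ k → 3 ≤ (m - 1) * (k - 1) := fun m k hm hk =>
    Nat.mul_le_mul (Nat.le_sub_one_of_lt hm) (Nat.le_sub_one_of_lt hk)
  obtain ⟨hsum, ε, hε, havoid⟩ := mainTheorem5_general
  exact ⟨fun m k hm hk => hsum m k (hmk m k hm hk), ε, hε, fun V _ p m n hm =>
    havoid V p m n (by omega) fun x _ hx => hmk m _ hm hx⟩
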